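/- There is an absolute constant $C>0$ such that the following holds. Let $d,n_0\ge 1$ be integers and let $c,\Delta,\kappa$ be real numbers. Then there is a constant $K>0$, depending only on $d,n_0,c,\Delta,\kappa$, with the following property. *Input.* Let $(a_j,b_j)_{j\ge 1}$ be an infinite stream with $a_j\in\mathbb{R}^d$, $b_j\in\mathbb{R}$ and $|a_{j,k}|\le c\,j^{\Delta}$ for all $j\ge1$ and $1\le k\le d$. For $n\in\mathbb{N}$ let $A\in\mathbb{R}^{n\times d}$ be the matrix with rows $a_1,\dots,a_n$, let $b=(b_1,\dots,b_n)^T$, and let $\sigma_d$ be the smallest (that is, the $d$-th largest) singular value of $A$. Let $f:\mathbb{N}\to(0,\infty)$ be non-decreasing with $f(n)\to\infty$. *Sketch.* Let $0<\delta<1/2$. Let $\varepsilon_i$ and $\delta_i$ ($i=0,1,2,\dots$) satisfy $0<\varepsilon_i\le 1$, $\varepsilon_i\le \kappa/(i+1)$, $\delta_i>0$ and $\sum_i\delta_i\le\delta$ (for instance $\varepsilon_i=\varepsilon_0/(i+1)$ with a fixed $\varepsilon_0\le 1$, or $\varepsilon_i=1/\log(2^in_0)$ when $n_0\ge3$, and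 $\delta_i=\delta/(c'(i+1)^2)$ with $c'\ge\pi^2/6$). Split the rows of the stream into consecutive blocks, the $i$-th consisting of $n_i=2^in_0$ rows. Let $m_i$ be integers with $$m_i\ \ge\ \frac{Cd}{\varepsilon_i}\log\frac1{\delta_i}\qquad\text{for all } i,$$ and let $S_i=\frac1{\sqrt{m_i}}R_i$, where the $R_i$ are random $m_i\times n_i$ matrices all of whose entries are independent and equal to $+1$ or $-1$ with probability $1/2$ each. For $n\in\mathbb{N}$ let $S=\mathrm{diag}(S_0,\dots,S_{l-1})$, where $l$ is the number of blocks needed to cover the first $n$ rows and the last block is restricted to its first columns, so that $S$ has exactly $n$ columns. *Claim.* For every $n$ with $f(n)>1$ and $\sigma_d^2\ge f(n)$, with probability at least $1-\delta$, every minimizer $\tilde x$ of $\|SAx-Sb\|$ over $x\in\mathbb{R}^d$ and every minimizer $x^*$ of $\|Ax-b\|$ over $x\in\mathbb{R}^d$ satisfy $$\|A\tilde x-b\|\ \le\ (1+\varepsilon)\,\|Ax^*-b\|\qquad\text{with}\quad \varepsilon=\frac{K}{\log f(n)}=O\!\left(\frac1{\log f(n)}\right).$$ All norms are Euclidean and $\log$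 is the natural logarithm. -/

import Mathlib

open MeasureTheory ProbabilityTheory Filter

noncomputable section

/-- The number of stream rows that are sketched together in step `i = 0, 1, 2, …`. -/
def blockSize (n₀ i : ℕ) : ℕ := 2 ^ i * n₀

/-- The number of stream rows that precede block `i`. -/
def blockStart (n₀ i : ℕ) : ℕ := ∑ t ∈ Finset.range i, blockSize n₀ t

/-- The number of blocks needed to cover the first `n` rows (the last block may be cut off). -/
def numBlocks (n₀ n : ℕ) : ℕ := sInf {l : ℕ | n ≤ blockStart n₀ l}

/-- Positions of the signs: block `i`, a row of the `m i × blockSize n₀ i` matrix of that block,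
and a column of it. -/
abbrev SignIndex (n₀ : ℕ) (m : ℕ → ℕ) : Type :=
  Σ i : ℕ, Fin (m i) × Fin (blockSize n₀ i)

/-- Independent random signs: each one is `1` or `-1` with probability `1/2` each. -/
structure IsRandomSigns {Ω ι : Type*} [MeasurableSpace Ω] (μ : Measure Ω)
    (R : ι → Ω → ℝ) : Prop where
  measurable : ∀ k, Measurable (R k)
  prob_one : ∀ k, μ {ω | R k ω = 1} = 1 / 2
  prob_neg_one : ∀ k, μ {ω | R k ω = -1} = 1 / 2
  indep : iIndepFun R μ

/-- The block-diagonal sketching matrix `S = diag(S_0, …, S_{l-1})` with `n` columns, where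
`S_i = R_i / √(m i)` and `R_i` is the `m i × blockSize n₀ i` sign matrix of block `i`;
the columns of the last block beyond the `n`-th column of `S` are cut off. -/
def sketchMatrix (n₀ : ℕ) (m : ℕ → ℕ) (n : ℕ) (R : SignIndex n₀ m → ℝ) :
    Matrix (Σ i : Fin (numBlocks n₀ n), Fin (m i)) (Fin n) ℝ :=
  Matrix.of fun p j =>
    if h : blockStart n₀ p.1 ≤ (j : ℕ) ∧ (j : ℕ) - blockStart n₀ p.1 < blockSize n₀ p.1 then
      R ⟨p.1, p.2, ⟨(j : ℕ) - blockStart n₀ p.1, h.2⟩⟩ / √(m p.1 : ℝ)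
    else 0

/-- The matrix formed by the first `n` rows of the stream `a`. -/
def prefixMatrix {d : ℕ} (a : ℕ → Fin d → ℝ) (n : ℕ) : Matrix (Fin n) (Fin d) ℝ :=
  Matrix.of fun j k => a j k

/-- The vector formed by the first `n` entries of the stream `b`. -/
def prefixVector (b : ℕ → ℝ) (n : ℕ) : EuclideanSpace ℝ (Fin n) :=
  WithLp.toLp 2 fun j => b j

/-- The Euclidean norm `‖M x - y‖`. -/
def residualNorm {ι : Type*} [Fintype ι] {d : ℕ} (M : Matrix ι (Fin d) ℝ)
    (y : EuclideanSpace ℝ ι) (x : EuclideanSpace ℝ (Fin d)) : ℝ :=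
  ‖Matrix.toEuclideanLin M x - y‖

/-- `x` is a minimizer of `‖M z - y‖` over all `z`. -/
def IsLeastSquaresSolution {ι : Type*} [Fintype ι] {d : ℕ} (M : Matrix ι (Fin d) ℝ)
    (y : EuclideanSpace ℝ ι) (x : EuclideanSpace ℝ (Fin d)) : Prop :=
  ∀ z : EuclideanSpace ℝ (Fin d), residualNorm M y x ≤ residualNorm M y z

/-- `σ_d`, the smallest of the `d` singular values of a matrix with `d ≥ 1` columns.
(In Mathlib they are numbered from `0` in descending order.) -/
def smallestSingularValue {ι : Type*} [Fintype ι] {d : ℕ} (M : Matrix ι (Fin d) ℝ) : ℝ :=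
  (Matrix.toEuclideanLin M).singularValues (d - 1)

end

/-! The columns of `A` together with `b` span a space of dimension at most `d + 1`, and so does its
part in each block. A sign matrix with of order `d / ε i * log (1 / δ i)` rows preserves the inner
products of that part up to a relative error `√(ε i) / 2` (`IsRandomSigns.measure_not_sketch_le`:
Bernstein concentration plus a net). A union bound over the blocks costs at most `δ`.

Accuracy `√ε` suffices for a `1 + ε` guarantee. By the normal equations the error vector `w = A (xt
- xs)` is orthogonal to the optimal residual `r`. The sketched normal equations give `‖w‖ ≤ √ρ *
‖r‖`, and Pythagoras squares this (`residualNorm_le_of_sketch`).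

Here `ρ` is the average of the `ε i`, weighted by the shares of the blocks in `‖A x‖ ^ 2`. Early
blocks have large `ε i`, but their rows are polynomially bounded while `‖A x‖ ^ 2 ≥ f n * ‖x‖ ^ 2`,
so their share is `2 ^ O(i) / f n`. Cutting at `i` of order `log (f n)` leaves late blocks with `ε i
= O(1 / log (f n))` and early blocks of total share `O(1 / log (f n))` (`sum_mul_le_div_log`). -/

/-! ### Moments and sub-Gaussianity of random signs. -/

section RandomSigns

variable {Ω ι : Type*} [MeasurableSpace Ω] {μ : Measure Ω} [IsProbabilityMeasure μ]

theorem IsRandomSigns.ae_eq_one_or_neg_one {X : ι → Ω → ℝ} (hX : IsRandomSigns μ X) (k : ι) :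
    ∀ᵐ ω ∂μ, X k ω = 1 ∨ X k ω = -1 := by
  have h1 : MeasurableSet {ω | X k ω = 1} := hX.measurable k (measurableSet_singleton 1)
  have h2 : MeasurableSet {ω | X k ω = -1} := hX.measurable k (measurableSet_singleton (-1))
  have hd : Disjoint {ω | X k ω = 1} {ω | X k ω = -1} := by
    rw [Set.disjoint_left]
    intro ω (h : X k ω = 1) (h' : X k ω = -1)
    linarith
  have hu : μ ({ω | X k ω = 1} ∪ {ω | X k ω = -1}) = 1 := by
    rw [measure_union hd h2, hX.prob_one, hX.prob_neg_one, ENNReal.add_halves]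
  exact (prob_compl_eq_zero_iff (h1.union h2)).2 hu

theorem IsRandomSigns.integral_eq_zero {X : ι → Ω → ℝ} (hX : IsRandomSigns μ X) (k : ι) :
    ∫ ω, X k ω ∂μ = 0 := by
  have h1 : MeasurableSet {ω | X k ω = 1} := hX.measurable k (measurableSet_singleton 1)
  have h2 : MeasurableSet {ω | X k ω = -1} := hX.measurable k (measurableSet_singleton (-1))
  have he : ∀ᵐ ω ∂μ, X k ω = {ω | X k ω = 1}.indicator (fun _ => (1 : ℝ)) ω -
      {ω | X k ω = -1}.indicator (fun _ => (1 : ℝ)) ω := by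
    filter_upwards [hX.ae_eq_one_or_neg_one k] with ω h
    rcases h with h | h <;> norm_num [Set.indicator, h]
  rw [integral_congr_ae he, integral_sub ((integrable_const 1).indicator h1)
    ((integrable_const 1).indicator h2), integral_indicator_const _ h1,
    integral_indicator_const _ h2]
  simp [measureReal_def, hX.prob_one, hX.prob_neg_one]

omit [IsProbabilityMeasure μ] in
theorem IsRandomSigns.precomp {κ : Type*} {X : ι → Ω → ℝ} (hX : IsRandomSigns μ X) {g : κ → ι}
    (hg : g.Injective) : IsRandomSigns μ (fun k => X (g k)) where
  measurable _ := hX.measurable _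
  prob_one _ := hX.prob_one _
  prob_neg_one _ := hX.prob_neg_one _
  indep := hX.indep.precomp hg

variable [Fintype ι]

theorem IsRandomSigns.hasSubgaussianMGF_sum {X : ι → Ω → ℝ} (hX : IsRandomSigns μ X)
    {v : ι → ℝ} (hv : ∑ t, v t ^ 2 = 1) :
    HasSubgaussianMGF (fun ω => ∑ t, v t * X t ω) 1 μ := by
  have hi : iIndepFun (fun t ω => v t * X t ω) μ :=
    hX.indep.comp (fun t x => v t * x) fun t => measurable_const_mul _
  -- Hoeffding's lemma on `[-1, 1]` gives each sign variance proxy `1`, and the factor `v t` turns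
  -- it into `v t ^ 2`.
  have h1 (t : ι) : HasSubgaussianMGF (fun ω => v t * X t ω) (‖v t‖₊ ^ 2) μ := by
    have h := hasSubgaussianMGF_of_mem_Icc_of_integral_eq_zero (μ := μ) (X := X t) (a := -1)
      (b := 1) (hX.measurable t).aemeasurable
      (by filter_upwards [hX.ae_eq_one_or_neg_one t] with ω h
          rcases h with h | h <;> norm_num [h]) (hX.integral_eq_zero t)
    convert! h.const_mul (v t) using 1
    ext
    norm_num
    exact (mul_one _).symm
  convert! HasSubgaussianMGF.sum_of_iIndepFun hi (s := Finset.univ) fun t _ => h1 t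
  ext
  simp [hv]

theorem IsRandomSigns.abs_sum_le {X : ι → Ω → ℝ} (hX : IsRandomSigns μ X) (v : ι → ℝ) :
    ∀ᵐ ω ∂μ, |∑ t, v t * X t ω| ≤ ∑ t, |v t| := by
  have h : ∀ᵐ ω ∂μ, ∀ t, X t ω = 1 ∨ X t ω = -1 := ae_all_iff.2 hX.ae_eq_one_or_neg_one
  filter_upwards [h] with ω h
  refine (Finset.abs_sum_le_sum_abs _ _).trans (Finset.sum_le_sum fun t _ => ?_)
  rcases h t with h | h <;> simp [h]

omit [Fintype ι] in
theorem IsRandomSigns.integral_mul {X : ι → Ω → ℝ} (hX : IsRandomSigns μ X) [DecidableEq ι]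
    (s t : ι) : ∫ ω, X s ω * X t ω ∂μ = if s = t then 1 else 0 := by
  split_ifs with h
  · subst h
    have : (fun ω => X s ω * X s ω) =ᵐ[μ] fun _ => 1 := by
      filter_upwards [hX.ae_eq_one_or_neg_one s] with ω h
      rcases h with h | h <;> norm_num [h]
    simp [integral_congr_ae this]
  · rw [(hX.indep.indepFun h).integral_fun_mul_eq_mul_integral
      (hX.measurable s).aestronglyMeasurable (hX.measurable t).aestronglyMeasurable,
      hX.integral_eq_zero]
    simp

omit [IsProbabilityMeasure μ] in
theorem IsRandomSigns.measurable_sum {X : ι → Ω → ℝ} (hX : IsRandomSigns μ X) (v : ι → ℝ) :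
    Measurable fun ω => ∑ t, v t * X t ω :=
  Finset.measurable_sum _ fun t _ => (hX.measurable t).const_mul _

theorem IsRandomSigns.integral_sum_sq {X : ι → Ω → ℝ} (hX : IsRandomSigns μ X)
    (v : ι → ℝ) : ∫ ω, (∑ t, v t * X t ω) ^ 2 ∂μ = ∑ t, v t ^ 2 := by
  classical
  have hint (s t : ι) : Integrable (fun ω => v s * v t * (X s ω * X t ω)) μ := by
    refine Integrable.const_mul (Integrable.of_mem_Icc (-1) 1
      ((hX.measurable s).mul (hX.measurable t)).aemeasurable ?_) _
    filter_upwards [hX.ae_eq_one_or_neg_one s, hX.ae_eq_one_or_neg_one t] with ω h h'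
    rcases h with h | h <;> rcases h' with h' | h' <;> norm_num [h, h']
  have he (ω : Ω) : (∑ t, v t * X t ω) ^ 2 = ∑ s, ∑ t, v s * v t * (X s ω * X t ω) := by
    rw [sq, Finset.sum_mul_sum]
    exact Finset.sum_congr rfl fun s _ => Finset.sum_congr rfl fun t _ => by ring
  simp_rw [he]
  rw [integral_finsetSum _ fun s _ => integrable_finsetSum _ fun t _ => hint s t]
  refine Finset.sum_congr rfl fun s _ => ?_
  rw [integral_finsetSum _ fun t _ => hint s t]
  simp_rw [integral_const_mul, hX.integral_mul]
  simp [sq]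

/-- Continuous functions of a bounded random variable are integrable. -/
theorem integrable_comp_of_abs_le {Y : Ω → ℝ} (hY : Measurable Y) {M : ℝ}
    (hM : ∀ᵐ ω ∂μ, |Y ω| ≤ M) {g : ℝ → ℝ} (hg : Continuous g) :
    Integrable (fun ω => g (Y ω)) μ := by
  obtain ⟨B, hB⟩ := isCompact_Icc.exists_bound_of_continuousOn (s := Set.Icc (-M) M)
    hg.continuousOn
  refine Integrable.of_bound (hg.measurable.comp hY).aestronglyMeasurable B ?_
  filter_upwards [hM] with ω h
  exact hB _ (abs_le.1 h)

end RandomSigns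

/-! ### Exponential moments of squares. -/

theorem lintegral_exp_mul_gaussianReal (t : ℝ) :
    ∫⁻ g, ENNReal.ofReal (Real.exp (t * g)) ∂(gaussianReal 0 1) =
      ENNReal.ofReal (Real.exp (t ^ 2 / 2)) := by
  have h := congrFun (mgf_fun_id_gaussianReal (μ := 0) (v := 1)) t
  rw [← ofReal_integral_eq_lintegral_ofReal (integrable_exp_mul_gaussianReal t)
    (ae_of_all _ fun _ => (Real.exp_pos _).le)]
  simp only [mgf] at h
  rw [h]
  simp

theorem lintegral_exp_sq_gaussianReal :
    ∫⁻ g, ENNReal.ofReal (Real.exp (g ^ 2 / 4)) ∂(gaussianReal 0 1) = ENNReal.ofReal √2 := by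
  rw [gaussianReal_of_var_ne_zero _ one_ne_zero,
    lintegral_withDensity_eq_lintegral_mul _ (measurable_gaussianPDF _ _) (by fun_prop)]
  have he (g : ℝ) : (gaussianPDF 0 1 * fun g => ENNReal.ofReal (Real.exp (g ^ 2 / 4))) g =
      ENNReal.ofReal ((√(2 * Real.pi))⁻¹ * Real.exp (-(1 / 4) * g ^ 2)) := by
    rw [Pi.mul_apply, gaussianPDF, ← ENNReal.ofReal_mul (gaussianPDFReal_nonneg _ _ _),
      gaussianPDFReal, mul_assoc, ← Real.exp_add]
    congr 3
    · norm_num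
    · norm_num
      ring
  simp_rw [he]
  rw [← ofReal_integral_eq_lintegral_ofReal
    ((integrable_exp_neg_mul_sq (by norm_num)).const_mul _)
    (ae_of_all _ fun _ => by positivity), integral_const_mul, integral_gaussian]
  congr 1
  rw [← Real.sqrt_inv, ← Real.sqrt_mul (by positivity)]
  congr 1
  field_simp
  norm_num

/-- The square of a `1`-sub-Gaussian random variable has exponential moments. -/
theorem ProbabilityTheory.HasSubgaussianMGF.lintegral_exp_sq_le {Ω : Type*} [MeasurableSpace Ω]
    {μ : Measure Ω} [IsProbabilityMeasure μ] {Y : Ω → ℝ} (hY : HasSubgaussianMGF Y 1 μ)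
    (hm : Measurable Y) :
    ∫⁻ ω, ENNReal.ofReal (Real.exp (Y ω ^ 2 / 4)) ∂μ ≤ ENNReal.ofReal √2 := by
  -- An auxiliary Gaussian `g` linearizes the square. After swapping the integrals, only the moment
  -- generating function of `Y` at `g / √2` is needed, and that is at most `exp (g ^ 2 / 4)`.
  have h1 (ω : Ω) : ENNReal.ofReal (Real.exp (Y ω ^ 2 / 4)) =
      ∫⁻ g, ENNReal.ofReal (Real.exp ((Y ω / √2) * g)) ∂(gaussianReal 0 1) := by
    rw [lintegral_exp_mul_gaussianReal, div_pow, Real.sq_sqrt (by norm_num)]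
    congr 2
    ring
  simp_rw [h1]
  rw [lintegral_lintegral_swap (by fun_prop), ← lintegral_exp_sq_gaussianReal]
  refine lintegral_mono fun g => ?_
  have h2 (ω : Ω) : Y ω / √2 * g = g / √2 * Y ω := by ring
  simp_rw [h2]
  rw [← ofReal_integral_eq_lintegral_ofReal (hY.integrable_exp_mul _)
    (ae_of_all _ fun _ => (Real.exp_pos _).le)]
  refine ENNReal.ofReal_le_ofReal ((hY.mgf_le _).trans_eq ?_)
  rw [div_pow, Real.sq_sqrt (by norm_num)]
  congr 1
  push_cast
  ring

/-- Second-order Taylor expansion of `exp`. The linear term is kept exact so that centring can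
cancel it after integration. In the remainder, `y ^ 4 ≤ 128 * exp (y ^ 2 / 8)`, and `|l| ≤ 1 / 8`
supplies a second factor `exp (y ^ 2 / 8)`. -/
theorem exp_mul_sq_le {l : ℝ} (hl : |l| ≤ 1 / 8) (y : ℝ) :
    Real.exp (l * y ^ 2) ≤ 1 + l * y ^ 2 + l ^ 2 * (128 * Real.exp (y ^ 2 / 4)) := by
  have h1 : Real.exp (l * y ^ 2) - (1 + l * y ^ 2) ≤
      |l * y ^ 2| ^ 2 * Real.exp |l * y ^ 2| := by
    have h := Complex.norm_exp_sub_sum_le_norm_mul_exp ((l * y ^ 2 : ℝ) : ℂ) 2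
    simp only [Finset.sum_range_succ, Finset.sum_range_zero, Nat.factorial, pow_zero, pow_one,
      zero_add, mul_one, Nat.cast_one, div_one] at h
    rw [← Complex.ofReal_exp, ← Complex.ofReal_one, ← Complex.ofReal_add, ← Complex.ofReal_sub,
      Complex.norm_real, Complex.norm_real] at h
    exact (le_abs_self _).trans h
  have h2 : |l * y ^ 2| ≤ y ^ 2 / 8 := by
    rw [abs_mul, abs_of_nonneg (sq_nonneg y)]
    nlinarith [sq_nonneg y]
  have h3 := Real.quadratic_le_exp_of_nonneg (x := y ^ 2 / 8) (by positivity)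
  have h4 : (y ^ 2) ^ 2 ≤ 128 * Real.exp (y ^ 2 / 8) := by nlinarith [sq_nonneg y]
  have h5 : |l * y ^ 2| ^ 2 * Real.exp |l * y ^ 2| ≤
      l ^ 2 * (128 * Real.exp (y ^ 2 / 8)) * Real.exp (y ^ 2 / 8) := by
    rw [sq_abs, mul_pow]
    gcongr
  have h6 : Real.exp (y ^ 2 / 8) * Real.exp (y ^ 2 / 8) = Real.exp (y ^ 2 / 4) := by
    rw [← Real.exp_add]
    ring_nf
  rw [mul_assoc, mul_assoc 128, h6] at h5
  linarith

/-- The centred square of a normalized sum of random signs is sub-exponential. -/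
theorem IsRandomSigns.integral_exp_sum_sq_le {Ω ι : Type*} [MeasurableSpace Ω] {μ : Measure Ω}
    [IsProbabilityMeasure μ] [Fintype ι] {X : ι → Ω → ℝ} (hX : IsRandomSigns μ X) {v : ι → ℝ}
    (hv : ∑ t, v t ^ 2 = 1) {l : ℝ} (hl : |l| ≤ 1 / 8) :
    ∫ ω, Real.exp (l * ((∑ t, v t * X t ω) ^ 2 - 1)) ∂μ ≤ Real.exp (200 * l ^ 2) := by
  set Y : Ω → ℝ := fun ω => ∑ t, v t * X t ω with hY
  have hm : Measurable Y := hX.measurable_sum v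
  have hint {g : ℝ → ℝ} (hg : Continuous g) : Integrable (fun ω => g (Y ω)) μ :=
    integrable_comp_of_abs_le hm (hX.abs_sum_le v) hg
  have h1 : ∫ ω, Real.exp (Y ω ^ 2 / 4) ∂μ ≤ √2 := by
    have h := (hX.hasSubgaussianMGF_sum hv).lintegral_exp_sq_le hm
    rw [← ofReal_integral_eq_lintegral_ofReal (hint (g := fun y => Real.exp (y ^ 2 / 4))
      (by fun_prop)) (ae_of_all _ fun _ => (Real.exp_pos _).le)] at h
    exact (ENNReal.ofReal_le_ofReal_iff (by positivity)).1 h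
  have h2 : ∫ ω, Y ω ^ 2 ∂μ = 1 := by rw [← hv, ← hX.integral_sum_sq v]
  have i1 : Integrable (fun ω => 1 + l * Y ω ^ 2) μ := hint (g := fun y => 1 + l * y ^ 2) (by fun_prop)
  have i2 : Integrable (fun ω => l ^ 2 * (128 * Real.exp (Y ω ^ 2 / 4))) μ :=
    hint (g := fun y => l ^ 2 * (128 * Real.exp (y ^ 2 / 4))) (by fun_prop)
  -- The constant `200` exceeds `128 * 1.5`, which bounds `128 * √2`.
  have h3 : ∫ ω, Real.exp (l * Y ω ^ 2) ∂μ ≤ 1 + l + l ^ 2 * 200 := by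
    calc ∫ ω, Real.exp (l * Y ω ^ 2) ∂μ
        ≤ ∫ ω, (1 + l * Y ω ^ 2 + l ^ 2 * (128 * Real.exp (Y ω ^ 2 / 4))) ∂μ :=
          integral_mono (hint (g := fun y => Real.exp (l * y ^ 2)) (by fun_prop)) (i1.add i2)
            fun ω => exp_mul_sq_le hl (Y ω)
      _ = 1 + l + l ^ 2 * (128 * ∫ ω, Real.exp (Y ω ^ 2 / 4) ∂μ) := by
          rw [integral_add i1 i2, integral_add (integrable_const _)
            (hint (g := fun y => l * y ^ 2) (by fun_prop)), integral_const_mul, integral_const_mul,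
            integral_const_mul, h2]
          simp
      _ ≤ 1 + l + l ^ 2 * 200 := by
          have : √2 ≤ 1.5 := by rw [Real.sqrt_le_left (by norm_num)]; norm_num
          gcongr
          linarith
  have h4 (ω : Ω) : Real.exp (l * (Y ω ^ 2 - 1)) = Real.exp (-l) * Real.exp (l * Y ω ^ 2) := by
    rw [← Real.exp_add]
    ring_nf
  change ∫ ω, Real.exp (l * (Y ω ^ 2 - 1)) ∂μ ≤ _
  simp_rw [h4]
  rw [integral_const_mul]
  have h5 : 1 + l + l ^ 2 * 200 ≤ Real.exp (l + l ^ 2 * 200) := by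
    have := Real.add_one_le_exp (l + l ^ 2 * 200)
    linarith
  calc Real.exp (-l) * ∫ ω, Real.exp (l * Y ω ^ 2) ∂μ
      ≤ Real.exp (-l) * Real.exp (l + l ^ 2 * 200) := by gcongr; exact h3.trans h5
    _ = Real.exp (200 * l ^ 2) := by rw [← Real.exp_add]; ring_nf

/-! ### Concentration for sign matrices. -/

/-- Functions of disjoint rows of an array of independent variables factor under the integral. -/
theorem ProbabilityTheory.iIndepFun.mgf_sum_rows {Ω ι κ : Type*} [MeasurableSpace Ω]
    {μ : Measure Ω} [Fintype κ] {X : ι × κ → Ω → ℝ}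
    (hX : iIndepFun X μ) (hm : ∀ k, Measurable (X k)) {g : (κ → ℝ) → ℝ} (hg : Measurable g)
    (s : Finset ι) (l : ℝ) :
    mgf (fun ω => ∑ r ∈ s, g fun t => X (r, t) ω) μ l =
      ∏ r ∈ s, mgf (fun ω => g fun t => X (r, t) ω) μ l := by
  classical
  have := hX.isProbabilityMeasure
  have hrow (r : ι) : Measurable fun ω => g fun t => X (r, t) ω :=
    hg.comp (measurable_pi_lambda _ fun t => hm _)
  induction s using Finset.induction_on with
  | empty => simp
  | insert r s hr ih =>
    have hd : Disjoint (({r} : Finset ι) ×ˢ (Finset.univ : Finset κ)) (s ×ˢ Finset.univ) := by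
      rw [Finset.disjoint_left]
      rintro ⟨a, b⟩ h h'
      simp only [Finset.mem_product, Finset.mem_singleton, Finset.mem_univ, and_true] at h h'
      exact hr (h ▸ h')
    have hi := hX.indepFun_finset _ _ hd hm
    let F : ((({r} : Finset ι) ×ˢ (Finset.univ : Finset κ) : Finset (ι × κ)) → ℝ) → ℝ :=
      fun x => g fun t => x ⟨(r, t), by simp⟩
    let G : ((s ×ˢ (Finset.univ : Finset κ) : Finset (ι × κ)) → ℝ) → ℝ :=
      fun x => ∑ q : s, g fun t => x ⟨(q, t), by simp⟩
    have hF : Measurable F := hg.comp (measurable_pi_lambda _ fun t => measurable_pi_apply _)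
    have hG : Measurable G := Finset.measurable_sum _ fun q _ =>
      hg.comp (measurable_pi_lambda _ fun t => measurable_pi_apply _)
    have hFG := hi.comp hF hG
    have e2 : G ∘ (fun ω (i : (s ×ˢ (Finset.univ : Finset κ) : Finset (ι × κ))) => X i ω) =
        fun ω => ∑ q ∈ s, g fun t => X (q, t) ω := by
      ext ω
      exact Finset.sum_coe_sort s fun q => g fun t => X (q, t) ω
    rw [e2] at hFG
    rw [Finset.prod_insert hr, ← ih]
    simp_rw [Finset.sum_insert hr]
    refine hFG.mgf_add (X := fun ω => g fun t => X (r, t) ω) ?_ ?_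
    · exact ((hrow r).const_mul l).exp.aestronglyMeasurable
    · exact ((Finset.measurable_sum s fun q _ => hrow q).const_mul l).exp.aestronglyMeasurable

section SignMatrix

variable {Ω ι κ : Type*} [MeasurableSpace Ω] {μ : Measure Ω} [IsProbabilityMeasure μ]
  [Fintype ι] [Fintype κ]

/-- Bernstein-type concentration of `‖R v‖²` for a sign matrix `R` and a unit vector `v`. -/
theorem IsRandomSigns.measure_abs_sum_rows_sq_sub_ge_le {X : ι × κ → Ω → ℝ}
    (hX : IsRandomSigns μ X) {v : κ → ℝ} (hv : ∑ t, v t ^ 2 = 1) {η : ℝ} (h0 : 0 ≤ η)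
    (h1 : η ≤ 1) :
    μ.real {ω | η * Fintype.card ι ≤ |∑ r, ((∑ t, v t * X (r, t) ω) ^ 2 - 1)|} ≤
      2 * Real.exp (-(Fintype.card ι * η ^ 2 / 800)) := by
  set Z : Ω → ℝ := fun ω => ∑ r, ((∑ t, v t * X (r, t) ω) ^ 2 - 1) with hZ
  have hrow (r : ι) : IsRandomSigns μ fun t => X (r, t) :=
    hX.precomp (g := fun t => (r, t)) fun a b h => (Prod.mk.inj h).2
  have hg : Measurable fun x : κ → ℝ => (∑ t, v t * x t) ^ 2 - 1 := by fun_prop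
  have hmgf {l : ℝ} (hl : |l| ≤ 1 / 8) : mgf Z μ l ≤ Real.exp (Fintype.card ι * (200 * l ^ 2)) := by
    rw [hZ, hX.indep.mgf_sum_rows hX.measurable hg, Real.exp_nat_mul, Fintype.card,
      ← Finset.prod_const]
    exact Finset.prod_le_prod (fun _ _ => mgf_nonneg) fun r _ =>
      (hrow r).integral_exp_sum_sq_le hv hl
  have hZm : Measurable Z := Finset.measurable_sum _ fun r _ =>
    (((hrow r).measurable_sum v).pow_const 2).sub_const 1
  have hZb : ∀ᵐ ω ∂μ, |Z ω| ≤ Fintype.card ι * ((∑ t, |v t|) ^ 2 + 1) := by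
    filter_upwards [ae_all_iff.2 fun r => (hrow r).abs_sum_le v] with ω h
    refine (Finset.abs_sum_le_sum_abs _ _).trans ?_
    rw [← nsmul_eq_mul]
    refine Finset.sum_le_card_nsmul _ _ _ fun r _ => ?_
    refine (abs_sub _ _).trans ?_
    rw [abs_one, abs_pow]
    gcongr
    exact h r
  have hint (l : ℝ) : Integrable (fun ω => Real.exp (l * Z ω)) μ :=
    integrable_comp_of_abs_le hZm hZb (g := fun z => Real.exp (l * z)) (by fun_prop)
  have hup : μ.real {ω | η * Fintype.card ι ≤ Z ω} ≤
      Real.exp (-(Fintype.card ι * η ^ 2 / 800)) := by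
    -- The choice `t = η / 400` minimizes the Chernoff exponent `-t * η + 200 * t ^ 2`, with value
    -- `-η ^ 2 / 800`.
    refine (measure_ge_le_exp_mul_mgf (t := η / 400) _ (by positivity) (hint _)).trans ?_
    have h := hmgf (l := η / 400) (by rw [abs_of_nonneg (by positivity)]; linarith)
    refine (mul_le_mul_of_nonneg_left h (Real.exp_pos _).le).trans_eq ?_
    rw [← Real.exp_add]
    ring_nf
  have hlo : μ.real {ω | Z ω ≤ -(η * Fintype.card ι)} ≤
      Real.exp (-(Fintype.card ι * η ^ 2 / 800)) := by
    refine (measure_le_le_exp_mul_mgf (t := -(η / 400)) _ (by linarith) (hint _)).trans ?_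
    have h := hmgf (l := -(η / 400)) (by rw [abs_neg, abs_of_nonneg (by positivity)]; linarith)
    refine (mul_le_mul_of_nonneg_left h (Real.exp_pos _).le).trans_eq ?_
    rw [← Real.exp_add]
    ring_nf
  have hsub : {ω | η * Fintype.card ι ≤ |Z ω|} ⊆
      {ω | η * Fintype.card ι ≤ Z ω} ∪ {ω | Z ω ≤ -(η * Fintype.card ι)} := fun ω h => by
    rcases le_abs.1 (show η * Fintype.card ι ≤ |Z ω| from h) with h | h
    · exact Or.inl h
    · exact Or.inr (by simp only [Set.mem_ofPred_eq]; linarith)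
  calc μ.real {ω | η * Fintype.card ι ≤ |Z ω|}
      ≤ _ := measureReal_mono hsub
    _ ≤ _ := measureReal_union_le _ _
    _ ≤ _ := by linarith

/-- Concentration of `‖R v‖²` for a sign matrix `R` and an arbitrary vector `v`. -/
theorem IsRandomSigns.measure_abs_sum_rows_sq_sub_gt_le {X : ι × κ → Ω → ℝ}
    (hX : IsRandomSigns μ X) (v : EuclideanSpace ℝ κ) {η : ℝ} (h0 : 0 ≤ η) (h1 : η ≤ 1) :
    μ.real {ω | η * Fintype.card ι * ‖v‖ ^ 2 <
        |∑ r, (∑ t, v t * X (r, t) ω) ^ 2 - Fintype.card ι * ‖v‖ ^ 2|} ≤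
      2 * Real.exp (-(Fintype.card ι * η ^ 2 / 800)) := by
  -- The strict inequality makes the event empty for `v = 0`, a case that does arise from
  -- differences of net points.
  rcases eq_or_ne v 0 with rfl | hv
  · simp
    positivity
  have hn : 0 < ‖v‖ := norm_pos_iff.2 hv
  have hu : ∑ t, (v t / ‖v‖) ^ 2 = 1 := by
    simp_rw [div_pow]
    rw [← Finset.sum_div, ← EuclideanSpace.real_norm_sq_eq, div_self (by positivity)]
  refine (measureReal_mono fun ω h => ?_).trans
    (hX.measure_abs_sum_rows_sq_sub_ge_le hu h0 h1)
  have he (r : ι) : ∑ t, v t / ‖v‖ * X (r, t) ω = (∑ t, v t * X (r, t) ω) / ‖v‖ := by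
    rw [Finset.sum_div]
    exact Finset.sum_congr rfl fun t _ => by ring
  simp only [Set.mem_ofPred_eq] at h ⊢
  simp_rw [he, div_pow]
  have hs : ∑ r, ((∑ t, v t * X (r, t) ω) ^ 2 / ‖v‖ ^ 2 - 1) =
      (∑ r, (∑ t, v t * X (r, t) ω) ^ 2 - Fintype.card ι * ‖v‖ ^ 2) / ‖v‖ ^ 2 := by
    rw [Finset.sum_sub_distrib, ← Finset.sum_div, sub_div,
      mul_div_cancel_right₀ _ (by positivity)]
    simp
  rw [hs, abs_div, abs_of_pos (show (0 : ℝ) < ‖v‖ ^ 2 by positivity), le_div_iff₀ (by positivity)]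
  exact h.le

end SignMatrix

/-! ### Nets and subspace embeddings. -/

/-- The closed unit ball of a finite-dimensional space has a `1/2`-net of exponential size. -/
theorem exists_half_net (E : Type*) [NormedAddCommGroup E] [NormedSpace ℝ E]
    [FiniteDimensional ℝ E] :
    ∃ N : Finset E, N.card ≤ 5 ^ Module.finrank ℝ E ∧ (∀ x ∈ N, ‖x‖ ≤ 1) ∧
      ∀ x : E, ‖x‖ ≤ 1 → ∃ y ∈ N, ‖x - y‖ ≤ 1 / 2 := by
  classical
  let P (s : Finset E) : Prop :=
    (∀ x ∈ s, ‖x‖ ≤ 1) ∧ ∀ x ∈ s, ∀ y ∈ s, x ≠ y → 1 / 2 ≤ ‖x - y‖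
  have hcard (s : Finset E) (hs : P s) : s.card ≤ 5 ^ Module.finrank ℝ E := by
    -- Doubling turns `1/2`-separated points of the unit ball into `1`-separated points of the ball
    -- of radius `2`, the setting of the Besicovitch bound `5 ^ dim`.
    have hinj : Function.Injective fun x : E => (2 : ℝ) • x :=
      smul_right_injective E two_ne_zero
    rw [← Finset.card_image_of_injective s hinj]
    refine Besicovitch.card_le_of_separated _ ?_ ?_
    · simp only [Finset.mem_image, forall_exists_index, and_imp, forall_apply_eq_imp_iff₂]
      intro x hx
      rw [norm_smul]
      norm_num
      linarith [hs.1 x hx]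
    · simp only [Finset.mem_image, forall_exists_index, and_imp, forall_apply_eq_imp_iff₂]
      intro x hx y hy hxy
      rw [← smul_sub, norm_smul]
      have := hs.2 x hx y hy fun h => hxy (h ▸ rfl)
      norm_num
      linarith
  -- A separated set of maximal size is a net, since any uncovered point could be added to it.
  obtain ⟨s, hs, hn⟩ := Nat.findGreatest_spec (P := fun n => ∃ s, P s ∧ s.card = n)
    (n := 5 ^ Module.finrank ℝ E) (Nat.zero_le _) ⟨∅, by simp [P], rfl⟩
  refine ⟨s, hcard s hs, hs.1, fun x hx => ?_⟩
  by_contra! h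
  have hxs : x ∉ s := fun hxs => by
    have := h x hxs
    norm_num at this
  have hP : P (insert x s) := by
    refine ⟨fun y hy => ?_, fun y hy z hz hyz => ?_⟩
    · rcases Finset.mem_insert.1 hy with rfl | hy
      exacts [hx, hs.1 y hy]
    · rcases Finset.mem_insert.1 hy with hy | hy <;> rcases Finset.mem_insert.1 hz with hz | hz
      · exact absurd (hy.trans hz.symm) hyz
      · exact hy ▸ (h z hz).le
      · rw [norm_sub_rev]
        exact hz ▸ (h y hy).le
      · exact hs.2 y hy z hz hyz
  have := Nat.le_findGreatest (P := fun n => ∃ s, P s ∧ s.card = n) (hcard _ hP) ⟨_, hP, rfl⟩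
  rw [← hn, Finset.card_insert_of_notMem hxs] at this
  omega

/-- Approximating a unit vector by the net costs at most `‖T‖ / 2`, which is absorbed on the left.
-/
theorem ContinuousLinearMap.opNorm_le_of_half_net {E F : Type*} [NormedAddCommGroup E]
    [NormedSpace ℝ E] [NormedAddCommGroup F] [NormedSpace ℝ F] {N : Finset E}
    (hN : ∀ x : E, ‖x‖ ≤ 1 → ∃ y ∈ N, ‖x - y‖ ≤ 1 / 2) (T : E →L[ℝ] F) {c : ℝ} (hc : 0 ≤ c)
    (h : ∀ x ∈ N, ‖T x‖ ≤ c) : ‖T‖ ≤ 2 * c := by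
  have : ‖T‖ ≤ c + ‖T‖ * (1 / 2) := by
    refine T.opNorm_le_of_unit_norm (by positivity) fun x hx => ?_
    obtain ⟨y, hy, hxy⟩ := hN x hx.le
    calc ‖T x‖ = ‖T y + T (x - y)‖ := by rw [map_sub, add_sub_cancel]
      _ ≤ ‖T y‖ + ‖T (x - y)‖ := norm_add_le _ _
      _ ≤ c + ‖T‖ * (1 / 2) := by
        gcongr
        · exact h y hy
        · exact (T.le_opNorm _).trans (by gcongr)
  linarith

/-- If `T` nearly preserves (up to the factor `c`) the squared norms of sums and differences of
points of a `1/2`-net, it nearly preserves all inner products. -/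
theorem abs_inner_map_sub_le_of_half_net {E F : Type*} [NormedAddCommGroup E]
    [InnerProductSpace ℝ E] [NormedAddCommGroup F] [InnerProductSpace ℝ F] {N : Finset E}
    (hN1 : ∀ x ∈ N, ‖x‖ ≤ 1) (hN : ∀ x : E, ‖x‖ ≤ 1 → ∃ y ∈ N, ‖x - y‖ ≤ 1 / 2) (T : E →L[ℝ] F)
    {c η : ℝ} (hη : 0 ≤ η)
    (h : ∀ x ∈ N, ∀ y ∈ N, |‖T (x + y)‖ ^ 2 - c * ‖x + y‖ ^ 2| ≤ η * ‖x + y‖ ^ 2 ∧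
      |‖T (x - y)‖ ^ 2 - c * ‖x - y‖ ^ 2| ≤ η * ‖x - y‖ ^ 2) (x y : E) :
    |inner ℝ (T x) (T y) - c * inner ℝ x y| ≤ 4 * η * ‖x‖ * ‖y‖ := by
  let B : E →L[ℝ] E →L[ℝ] ℝ := (innerSL ℝ).bilinearComp T T - c • innerSL ℝ
  have hB (x y : E) : B x y = inner ℝ (T x) (T y) - c * inner ℝ x y := by
    simp only [B, sub_apply, ContinuousLinearMap.bilinearComp_apply,
      smul_apply, smul_eq_mul]
    rfl
  have hnet (x : E) (hx : x ∈ N) (y : E) (hy : y ∈ N) : ‖B x y‖ ≤ η := by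
    rw [hB, Real.norm_eq_abs]
    obtain ⟨h1, h2⟩ := h x hx y hy
    have p1 := norm_add_sq_real x y
    have p2 := norm_sub_sq_real x y
    have p3 := norm_add_sq_real (T x) (T y)
    have p4 := norm_sub_sq_real (T x) (T y)
    rw [map_add] at h1
    rw [map_sub] at h2
    rw [abs_le] at h1 h2 ⊢
    -- The parallelogram law bounds the total error by `4 * η`. Polarization in `hd` divides it by
    -- `4`.
    have hs : η * ‖x + y‖ ^ 2 + η * ‖x - y‖ ^ 2 ≤ 4 * η := by
      have q1 : ‖x‖ ^ 2 ≤ 1 := pow_le_one₀ (norm_nonneg _) (hN1 x hx)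
      have q2 : ‖y‖ ^ 2 ≤ 1 := pow_le_one₀ (norm_nonneg _) (hN1 y hy)
      rw [p1, p2]
      nlinarith
    have hd : ‖T x + T y‖ ^ 2 - c * ‖x + y‖ ^ 2 - (‖T x - T y‖ ^ 2 - c * ‖x - y‖ ^ 2) =
        4 * (inner ℝ (T x) (T y) - c * inner ℝ x y) := by
      rw [p1, p2, p3, p4]
      ring
    constructor <;> linarith [h1.1, h1.2, h2.1, h2.2]
  -- The net argument is applied once in each variable of `B`, and each application costs a factor
  -- `2`.
  have h1 : ‖B‖ ≤ 2 * (2 * η) := B.opNorm_le_of_half_net hN (by positivity) fun x hx =>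
    (B x).opNorm_le_of_half_net hN hη (hnet x hx)
  rw [← hB, ← Real.norm_eq_abs]
  refine (B.le_opNorm₂ x y).trans ?_
  gcongr
  linarith

/-- A sign matrix, up to normalization, nearly preserves the inner products of a subspace. -/
theorem IsRandomSigns.measure_not_subspace_embedding_le {Ω ι κ : Type*} [MeasurableSpace Ω]
    {μ : Measure Ω} [IsProbabilityMeasure μ] [Fintype ι] [Fintype κ] {X : ι × κ → Ω → ℝ}
    (hX : IsRandomSigns μ X) (V : Submodule ℝ (EuclideanSpace ℝ κ)) {η : ℝ} (h0 : 0 ≤ η)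
    (h1 : η ≤ 1) :
    μ.real {ω | ¬ ∀ x ∈ V, ∀ y ∈ V,
      |∑ r, (∑ t, x t * X (r, t) ω) * (∑ t, y t * X (r, t) ω) -
        Fintype.card ι * inner ℝ x y| ≤ 4 * (η * Fintype.card ι) * ‖x‖ * ‖y‖} ≤
      4 * 25 ^ Module.finrank ℝ V * Real.exp (-(Fintype.card ι * η ^ 2 / 800)) := by
  classical
  obtain ⟨N, hcard, hN1, hN⟩ := exists_half_net V
  let bad (v : EuclideanSpace ℝ κ) : Set Ω := {ω | η * Fintype.card ι * ‖v‖ ^ 2 <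
        |∑ r, (∑ t, v t * X (r, t) ω) ^ 2 - Fintype.card ι * ‖v‖ ^ 2|}
  have hsub : {ω | ¬ ∀ x ∈ V, ∀ y ∈ V,
      |∑ r, (∑ t, x t * X (r, t) ω) * (∑ t, y t * X (r, t) ω) -
        Fintype.card ι * inner ℝ x y| ≤ 4 * (η * Fintype.card ι) * ‖x‖ * ‖y‖} ⊆
      ⋃ p ∈ N ×ˢ N, (bad (p.1 + p.2 : V) ∪ bad (p.1 - p.2 : V)) := by
    intro ω hω
    by_contra hgood
    simp only [Set.mem_iUnion, not_exists, Set.mem_union, not_or, Finset.mem_product, and_imp,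
      Prod.forall, bad, Set.mem_ofPred_eq, not_lt] at hgood
    refine hω fun x hx y hy => ?_
    let M : EuclideanSpace ℝ κ →L[ℝ] EuclideanSpace ℝ ι :=
      (Matrix.toEuclideanLin (Matrix.of fun r t => X (r, t) ω)).toContinuousLinearMap
    have hM (v : EuclideanSpace ℝ κ) (r : ι) : M v r = ∑ t, v t * X (r, t) ω := by
      simp [M, Matrix.toEuclideanLin, Matrix.mulVec, dotProduct, mul_comm]
    have hMn (v : EuclideanSpace ℝ κ) : ‖M v‖ ^ 2 = ∑ r, (∑ t, v t * X (r, t) ω) ^ 2 := by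
      rw [EuclideanSpace.real_norm_sq_eq]
      simp_rw [hM]
    have := abs_inner_map_sub_le_of_half_net hN1 hN (M.comp V.subtypeL) (c := Fintype.card ι)
      (η := η * Fintype.card ι) (by positivity) (fun u hu v hv => by
        simpa only [ContinuousLinearMap.comp_apply, Submodule.subtypeL_apply, hMn,
          Submodule.norm_coe] using hgood u v hu hv) ⟨x, hx⟩ ⟨y, hy⟩
    simpa [PiLp.inner_apply, hM, mul_comm] using this
  have hbad (v : EuclideanSpace ℝ κ) := hX.measure_abs_sum_rows_sq_sub_gt_le v h0 h1
  calc μ.real _ ≤ μ.real (⋃ p ∈ N ×ˢ N, (bad (p.1 + p.2 : V) ∪ bad (p.1 - p.2 : V))) :=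
        measureReal_mono hsub (measure_ne_top _ _)
    _ ≤ ∑ p ∈ N ×ˢ N, μ.real (bad (p.1 + p.2 : V) ∪ bad (p.1 - p.2 : V)) :=
        measureReal_biUnion_finset_le _ _
    _ ≤ ∑ p ∈ N ×ˢ N, 4 * Real.exp (-(Fintype.card ι * η ^ 2 / 800)) := by
        refine Finset.sum_le_sum fun p _ => (measureReal_union_le _ _).trans ?_
        have e1 := hbad (p.1 + p.2 : V)
        have e2 := hbad (p.1 - p.2 : V)
        change μ.real (bad _) ≤ _ at e1
        change μ.real (bad _) ≤ _ at e2
        linarith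
    _ = 4 * ((N.card : ℝ) * N.card) * Real.exp (-(Fintype.card ι * η ^ 2 / 800)) := by
        rw [Finset.sum_const, Finset.card_product, nsmul_eq_mul]
        push_cast
        ring
    _ ≤ _ := by
        have hc : (N.card : ℝ) ≤ 5 ^ Module.finrank ℝ V := by exact_mod_cast hcard
        have : (25 : ℝ) ^ Module.finrank ℝ V =
            5 ^ Module.finrank ℝ V * 5 ^ Module.finrank ℝ V := by
          rw [← mul_pow]
          norm_num
        rw [this]
        gcongr

/-- With `m ≥ C d ε⁻¹ log (1/δ)` rows, a sign matrix preserves the inner products of a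
`(d + 1)`-dimensional subspace up to a relative error `√ε / 2`, with probability `1 - δ`. -/
theorem IsRandomSigns.measure_not_sketch_le {Ω κ : Type*} [MeasurableSpace Ω]
    {μ : Measure Ω} [IsProbabilityMeasure μ] {m d : ℕ} [Fintype κ] {X : Fin m × κ → Ω → ℝ}
    (hX : IsRandomSigns μ X) (V : Submodule ℝ (EuclideanSpace ℝ κ))
    (hV : Module.finrank ℝ V ≤ d + 1) (hd : 1 ≤ d) {ε δ : ℝ} (hε : 0 < ε) (hε1 : ε ≤ 1)
    (hδ : 0 < δ) (hδ1 : δ < 1 / 2) (hm : 1000000 * d / ε * Real.log (1 / δ) ≤ m) :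
    μ.real {ω | ¬ ∀ x ∈ V, ∀ y ∈ V,
      |∑ r, (∑ t, x t * X (r, t) ω) * (∑ t, y t * X (r, t) ω) / m - inner ℝ x y| ≤
        √ε / 2 * ‖x‖ * ‖y‖} ≤ δ := by
  have hd' : (1 : ℝ) ≤ d := by exact_mod_cast hd
  have hlog2 : Real.log 2 ≤ Real.log (1 / δ) :=
    Real.log_le_log (by norm_num) (by rw [le_div_iff₀ hδ]; linarith)
  have hlog20 : 0 < Real.log 2 := Real.log_pos (by norm_num)
  have hL : 0 < Real.log (1 / δ) := hlog20.trans_le hlog2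
  have hm0 : (0 : ℝ) < m := lt_of_lt_of_le (by positivity) hm
  have hsqrt : √ε ≤ 1 := Real.sqrt_le_one.2 hε1
  -- The factor `4` of the embedding bound turns `√ε / 8` into `√ε / 2`.
  have h := hX.measure_not_subspace_embedding_le V (η := √ε / 8) (by positivity) (by linarith)
  rw [Fintype.card_fin] at h
  refine (measureReal_mono (Set.compl_subset_compl.2 fun ω hgood x hx y hy => ?_)).trans (h.trans ?_)
  · have := hgood x hx y hy
    rw [← Finset.sum_div]
    have e : (∑ r, (∑ t, x t * X (r, t) ω) * (∑ t, y t * X (r, t) ω)) / m - inner ℝ x y =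
        (∑ r, (∑ t, x t * X (r, t) ω) * (∑ t, y t * X (r, t) ω) - m * inner ℝ x y) / m := by
      field_simp
    rw [e, abs_div, abs_of_pos hm0, div_le_iff₀ hm0]
    linarith
  · have hmε : 1000000 * d * Real.log (1 / δ) ≤ m * ε := by
      rw [div_mul_eq_mul_div, div_le_iff₀ hε] at hm
      exact hm
    -- The exponent is `m * ε / 51200`, and `1000000 / 51200 > 15`.
    have hexp : Real.exp (-(m * (√ε / 8) ^ 2 / 800)) ≤ Real.exp (-(15 * d * Real.log (1 / δ))) := by
      rw [Real.exp_le_exp, div_pow, Real.sq_sqrt hε.le]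
      have : 0 ≤ d * Real.log (1 / δ) := by positivity
      linarith
    -- The net size is at most `2 ^ (7 + 5 * d)`. It is paid for by `δ < 1 / 2` and `7 + 5 * d ≤ 12
    -- * d`.
    have h25 : (4 : ℝ) * 25 ^ Module.finrank ℝ V ≤ Real.exp (12 * d * Real.log (1 / δ)) := by
      calc (4 : ℝ) * 25 ^ Module.finrank ℝ V ≤ 2 ^ 2 * (2 ^ 5) ^ (d + 1) := by
            have : (25 : ℝ) ^ Module.finrank ℝ V ≤ 25 ^ (d + 1) :=
              pow_le_pow_right₀ (by norm_num) hV
            have : (25 : ℝ) ^ (d + 1) ≤ (2 ^ 5) ^ (d + 1) := by gcongr; norm_num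
            linarith
        _ = Real.exp ((7 + 5 * d : ℕ) * Real.log 2) := by
            rw [Real.exp_nat_mul, Real.exp_log (by norm_num), ← pow_mul, ← pow_add]
            congr 1
            ring
        _ ≤ Real.exp (12 * d * Real.log (1 / δ)) := by
            rw [Real.exp_le_exp]
            push_cast
            gcongr
            linarith
    calc 4 * 25 ^ Module.finrank ℝ V * Real.exp (-(m * (√ε / 8) ^ 2 / 800))
        ≤ Real.exp (12 * d * Real.log (1 / δ)) * Real.exp (-(15 * d * Real.log (1 / δ))) := by
          gcongr
      _ = Real.exp (-(3 * d * Real.log (1 / δ))) := by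
          rw [← Real.exp_add]
          ring_nf
      _ ≤ Real.exp (-Real.log (1 / δ)) := by
          rw [Real.exp_le_exp]
          nlinarith
      _ = δ := by rw [one_div, Real.log_inv, neg_neg, Real.exp_log hδ]

/-! ### Deterministic least squares. -/

/-- In an eigenbasis of `T* T` the squared norm is a sum weighted by eigenvalues, the last of which
is the smallest. -/
theorem sq_smallestSingularValue_mul_le {ι : Type*} [Fintype ι] {d : ℕ} (hd : 1 ≤ d)
    (M : Matrix ι (Fin d) ℝ) (y : EuclideanSpace ℝ (Fin d)) :
    smallestSingularValue M ^ 2 * ‖y‖ ^ 2 ≤ ‖Matrix.toEuclideanLin M y‖ ^ 2 := by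
  set T := Matrix.toEuclideanLin M
  have hfr : Module.finrank ℝ (EuclideanSpace ℝ (Fin d)) = d := by simp
  have hlt : d - 1 < d := by omega
  have hT := T.isSymmetric_adjoint_comp_self
  set e := hT.eigenvectorBasis hfr
  have h1 : ‖T y‖ ^ 2 = ∑ i, hT.eigenvalues hfr i * (e.repr y i) ^ 2 := by
    rw [← real_inner_self_eq_norm_sq, ← LinearMap.adjoint_inner_right, ← LinearMap.comp_apply,
      ← e.repr.inner_map_map, PiLp.inner_apply]
    refine Finset.sum_congr rfl fun i _ => ?_
    rw [hT.eigenvectorBasis_apply_self_apply hfr]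
    simp [e]
    ring
  rw [smallestSingularValue, T.sq_singularValues_of_lt hfr hlt, h1, ← e.repr.norm_map y,
    EuclideanSpace.real_norm_sq_eq, Finset.mul_sum]
  refine Finset.sum_le_sum fun i _ => ?_
  gcongr
  exact hT.eigenvalues_antitone hfr (Fin.mk_le_mk.2 (by omega))

/-- Normal equations: along `x + t • z` the increase of the squared residual is a nonnegative
quadratic in `t` without constant term, so its discriminant forces the linear coefficient to vanish.
-/
theorem IsLeastSquaresSolution.inner_eq_zero {ι : Type*} [Fintype ι] {d : ℕ}
    {M : Matrix ι (Fin d) ℝ} {y : EuclideanSpace ℝ ι} {x : EuclideanSpace ℝ (Fin d)}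
    (h : IsLeastSquaresSolution M y x) (z : EuclideanSpace ℝ (Fin d)) :
    inner ℝ (Matrix.toEuclideanLin M z) (Matrix.toEuclideanLin M x - y) = 0 := by
  set T := Matrix.toEuclideanLin M
  set s : ℝ := inner ℝ (T z) (T x - y)
  have key (t : ℝ) : 0 ≤ ‖T z‖ ^ 2 * (t * t) + 2 * s * t + 0 := by
    have h1 : ‖T x - y‖ ^ 2 ≤ ‖T (x + t • z) - y‖ ^ 2 := by
      gcongr
      exact h (x + t • z)
    have h2 : T (x + t • z) - y = t • T z + (T x - y) := by
      rw [map_add, map_smul]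
      abel
    rw [h2, norm_add_sq_real, norm_smul, mul_pow, inner_smul_left, Real.norm_eq_abs, sq_abs] at h1
    simp only [conj_trivial] at h1
    linarith
  have := discrim_le_zero key
  rw [discrim] at this
  nlinarith [sq_nonneg s]

/-- A sketch that keeps a constant fraction of the norms on the range of `A` and nearly preserves
the inner products with residuals yields nearly optimal least-squares solutions. -/
theorem residualNorm_le_of_sketch {ι κ : Type*} [Fintype ι] [Fintype κ] [DecidableEq κ] {d : ℕ}
    {A : Matrix κ (Fin d) ℝ} {S : Matrix ι κ ℝ} {b : EuclideanSpace ℝ κ} {ρ : ℝ} (hρ : 0 ≤ ρ)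
    (hS : ∀ x, ‖Matrix.toEuclideanLin A x‖ ^ 2 / 2 ≤
      ‖Matrix.toEuclideanLin S (Matrix.toEuclideanLin A x)‖ ^ 2)
    (hSb : ∀ x z, |inner ℝ (Matrix.toEuclideanLin S (Matrix.toEuclideanLin A x))
        (Matrix.toEuclideanLin S (Matrix.toEuclideanLin A z - b)) -
          inner ℝ (Matrix.toEuclideanLin A x) (Matrix.toEuclideanLin A z - b)| ≤
      √ρ / 2 * ‖Matrix.toEuclideanLin A x‖ * ‖Matrix.toEuclideanLin A z - b‖)
    {xt xs : EuclideanSpace ℝ (Fin d)}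
    (ht : IsLeastSquaresSolution (S * A) (Matrix.toEuclideanLin S b) xt)
    (hs : IsLeastSquaresSolution A b xs) :
    residualNorm A b xt ≤ (1 + ρ) * residualNorm A b xs := by
  have hmul (x : EuclideanSpace ℝ (Fin d)) : Matrix.toEuclideanLin (S * A) x =
      Matrix.toEuclideanLin S (Matrix.toEuclideanLin A x) := by
    rw [Matrix.toEuclideanLin, Matrix.toLpLin_mul_same]
    rfl
  have n1 := ht.inner_eq_zero (xt - xs)
  have n2 := hs.inner_eq_zero (xt - xs)
  rw [hmul, hmul] at n1
  rw [residualNorm, residualNorm]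
  have h1 := hS (xt - xs)
  have h2 := hSb (xt - xs) xs
  set w := Matrix.toEuclideanLin A (xt - xs) with hw
  set r := Matrix.toEuclideanLin A xs - b with hr
  have hwr : Matrix.toEuclideanLin A xt - b = w + r := by
    rw [hw, hr, map_sub]
    abel
  rw [← map_sub, hwr, map_add, inner_add_right, real_inner_self_eq_norm_sq] at n1
  rw [n2, sub_zero] at h2
  -- By the two normal equations `‖S w‖ ^ 2 = -⟪S w, S r⟫` and `⟪w, r⟫ = 0`. Hence `‖w‖ ^ 2 / 2 ≤ ‖S
  -- w‖ ^ 2 ≤ √ρ / 2 * ‖w‖ * ‖r‖`.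
  have h3 : ‖w‖ ^ 2 ≤ √ρ * ‖w‖ * ‖r‖ := by
    have := (abs_le.1 h2).1
    linarith
  have h4 : ‖w‖ ≤ √ρ * ‖r‖ := by
    rcases (norm_nonneg w).eq_or_lt with h | h
    · rw [← h]
      positivity
    · refine le_of_mul_le_mul_left ?_ h
      linarith
  have h5 : ‖w + r‖ ^ 2 ≤ ((1 + ρ) * ‖r‖) ^ 2 := by
    rw [norm_add_sq_real, n2]
    have h6 : ‖w‖ ^ 2 ≤ ρ * ‖r‖ ^ 2 := by
      calc ‖w‖ ^ 2 ≤ (√ρ * ‖r‖) ^ 2 := by gcongr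
        _ = ρ * ‖r‖ ^ 2 := by rw [mul_pow, Real.sq_sqrt hρ]
    nlinarith [mul_nonneg hρ (sq_nonneg ‖r‖), mul_nonneg (sq_nonneg ρ) (sq_nonneg ‖r‖)]
  rw [hwr]
  exact (sq_le_sq₀ (norm_nonneg _) (by positivity)).1 h5

/-! ### Averaging the error parameters over blocks. -/

/-- If the weight of the `i`-th term is `O(1/i)` and the share of the `i`-th term is `2^{O(i)}/F`,
then the weighted average is `O(1/log F)`. -/
theorem sum_mul_le_div_log {l p : ℕ} (hp : 1 ≤ p) {κ D F s : ℝ} (hD : 0 ≤ D) (hF : 1 < F)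
    (hs : 0 ≤ s) {ε u : ℕ → ℝ} (hε1 : ∀ i, ε i ≤ 1)
    (hεκ : ∀ i, ε i ≤ κ / (i + 1)) (hu0 : ∀ i < l, 0 ≤ u i)
    (hu : ∀ i < l, u i ≤ D * (2 ^ i) ^ p * (s / F)) (hus : ∑ i ∈ Finset.range l, u i = s) :
    ∑ i ∈ Finset.range l, ε i * u i ≤ (2 * p * |κ| + 4 * D + 1) / Real.log F * s := by
  have hL : 0 < Real.log F := Real.log_pos hF
  set L := Real.log F with hLdef
  have hp' : (1 : ℝ) ≤ p := by exact_mod_cast hp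
  -- The cut is chosen so that `exp (p * τ) = √F`. Each block with `i < τ - 1` then has share at
  -- most `D / √F`, and every later one has `ε i ≤ |κ| / τ`.
  set τ : ℝ := L / (2 * p) with hτ
  have hτ0 : 0 < τ := by positivity
  have hexp : Real.exp (-(L / 2)) ≤ 8 / L ^ 2 := by
    have := Real.quadratic_le_exp_of_nonneg (x := L / 2) (by positivity)
    rw [Real.exp_neg, inv_eq_one_div, div_le_div_iff₀ (Real.exp_pos _) (by positivity)]
    nlinarith
  have hterm (i : ℕ) (hi : i < l) : ε i * u i ≤ |κ| / τ * u i +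
      if (i : ℝ) < τ - 1 then D * Real.exp (-(L / 2)) * s else 0 := by
    split_ifs with h
    · have h2 : (2 : ℝ) ^ i ≤ Real.exp τ := by
        rw [← Real.exp_log (show (0 : ℝ) < 2 by norm_num), ← Real.exp_nat_mul, Real.exp_le_exp]
        have : Real.log 2 ≤ 1 := Real.log_two_lt_d9.le.trans (by norm_num)
        have : (0 : ℝ) ≤ i := Nat.cast_nonneg i
        nlinarith
      have h3 : u i ≤ D * Real.exp (-(L / 2)) * s := by
        calc u i ≤ D * (2 ^ i) ^ p * (s / F) := hu i hi
          _ ≤ D * (Real.exp τ) ^ p * (s / F) := by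
            have : 0 ≤ s / F := div_nonneg hs (by linarith)
            gcongr
          _ = D * Real.exp (-(L / 2)) * s := by
            have e1 : F = Real.exp L := (Real.exp_log (by linarith)).symm
            rw [e1, ← Real.exp_nat_mul, div_eq_mul_inv, ← Real.exp_neg]
            have e2 : Real.exp (-(L / 2)) = Real.exp (p * τ) * Real.exp (-L) := by
              rw [← Real.exp_add, hτ]
              congr 1
              field_simp
              ring
            rw [e2]
            ring
      have h4 : ε i * u i ≤ u i := mul_le_of_le_one_left (hu0 i hi) (hε1 i)
      have h5 : 0 ≤ |κ| / τ * u i := mul_nonneg (by positivity) (hu0 i hi)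
      linarith
    · rw [add_zero]
      refine mul_le_mul_of_nonneg_right ((hεκ i).trans ?_) (hu0 i hi)
      exact div_le_div₀ (abs_nonneg _) (le_abs_self _) hτ0 (by linarith)
  have hcard : ((Finset.range l).filter fun i : ℕ => (i : ℝ) < τ - 1).card ≤ τ := by
    have hsub : ((Finset.range l).filter fun i : ℕ => (i : ℝ) < τ - 1) ⊆ Finset.range ⌊τ⌋₊ := by
      intro i hi
      have := (Finset.mem_filter.1 hi).2
      rw [Finset.mem_range, Nat.lt_iff_add_one_le, Nat.le_floor_iff hτ0.le]
      push_cast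
      linarith
    have := Finset.card_le_card hsub
    rw [Finset.card_range] at this
    exact (Nat.cast_le.2 this).trans (Nat.floor_le hτ0.le)
  calc ∑ i ∈ Finset.range l, ε i * u i
      ≤ ∑ i ∈ Finset.range l, (|κ| / τ * u i +
          if (i : ℝ) < τ - 1 then D * Real.exp (-(L / 2)) * s else 0) :=
        Finset.sum_le_sum fun i hi => hterm i (Finset.mem_range.1 hi)
    _ = |κ| / τ * s + ((Finset.range l).filter fun i : ℕ => (i : ℝ) < τ - 1).card *
          (D * Real.exp (-(L / 2)) * s) := by
        rw [Finset.sum_add_distrib, ← Finset.mul_sum, hus, ← Finset.sum_filter, Finset.sum_const,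
          nsmul_eq_mul]
    -- There are at most `τ` early blocks, and `exp (-L / 2) ≤ 8 / L ^ 2` still leaves a factor `1 /
    -- L` after multiplication by `τ`.
    _ ≤ |κ| / τ * s + τ * (D * (8 / L ^ 2) * s) := by gcongr
    _ = (2 * p * |κ| + 4 * D / p) / L * s := by
        rw [hτ]
        field_simp
        ring
    _ ≤ (2 * p * |κ| + 4 * D + 1) / L * s := by
        have : 4 * D / p ≤ 4 * D := div_le_self (by positivity) hp'
        exact mul_le_mul_of_nonneg_right (div_le_div_of_nonneg_right (by linarith) hL.le) hs

/-! ### Block decomposition of vectors and of the sketch. -/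

/-- The part of a vector that is indexed by block `i`, extended by zeros. -/
noncomputable def blockPart (n₀ n i : ℕ) :
    EuclideanSpace ℝ (Fin n) →ₗ[ℝ] EuclideanSpace ℝ (Fin (blockSize n₀ i)) where
  toFun v := WithLp.toLp 2 fun t =>
    if h : blockStart n₀ i + t < n then v ⟨blockStart n₀ i + t, h⟩ else 0
  map_add' v w := by
    ext t
    by_cases h : blockStart n₀ i + t < n <;> simp [h]
  map_smul' c v := by
    ext t
    by_cases h : blockStart n₀ i + t < n <;> simp [h]

theorem blockPart_apply (n₀ n i : ℕ) (v : EuclideanSpace ℝ (Fin n)) (t : Fin (blockSize n₀ i)) :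
    blockPart n₀ n i v t =
      if h : blockStart n₀ i + t < n then v ⟨blockStart n₀ i + t, h⟩ else 0 := rfl

/-- Every block has at least one row, so `n` blocks suffice and the infimum is attained. -/
theorem le_blockStart_numBlocks {n₀ : ℕ} (h0 : 1 ≤ n₀) (n : ℕ) :
    n ≤ blockStart n₀ (numBlocks n₀ n) := by
  refine Nat.sInf_mem (s := {l : ℕ | n ≤ blockStart n₀ l}) ⟨n, ?_⟩
  change n ≤ ∑ t ∈ Finset.range n, blockSize n₀ t
  calc n = ∑ t ∈ Finset.range n, 1 := by simp
    _ ≤ _ := Finset.sum_le_sum fun t _ => Nat.mul_pos (by positivity) h0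

theorem sum_range_blockStart (n₀ l : ℕ) (g : ℕ → ℝ) :
    ∑ j ∈ Finset.range (blockStart n₀ l), g j =
      ∑ i ∈ Finset.range l, ∑ t ∈ Finset.range (blockSize n₀ i), g (blockStart n₀ i + t) := by
  induction l with
  | zero => simp [blockStart]
  | succ l ih =>
    rw [Finset.sum_range_succ, ← ih, blockStart, Finset.sum_range_succ, ← blockStart,
      Finset.sum_range_add]

theorem sum_inner_blockPart {n₀ : ℕ} (h0 : 1 ≤ n₀) (n : ℕ) (v w : EuclideanSpace ℝ (Fin n)) :
    ∑ i ∈ Finset.range (numBlocks n₀ n), inner ℝ (blockPart n₀ n i v) (blockPart n₀ n i w) =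
      inner ℝ v w := by
  let g (j : ℕ) : ℝ := if h : j < n then v ⟨j, h⟩ * w ⟨j, h⟩ else 0
  have h1 : inner ℝ v w = ∑ j ∈ Finset.range (blockStart n₀ (numBlocks n₀ n)), g j := by
    rw [← Finset.sum_subset (Finset.range_subset_range.2 (le_blockStart_numBlocks h0 n))
      fun j _ hj => dif_neg (by simpa using hj), PiLp.inner_apply, Finset.sum_range]
    refine Finset.sum_congr rfl fun j _ => ?_
    simp [g, mul_comm]
  rw [h1, sum_range_blockStart]
  refine Finset.sum_congr rfl fun i _ => ?_
  rw [PiLp.inner_apply, Finset.sum_range]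
  refine Finset.sum_congr rfl fun t _ => ?_
  by_cases h : blockStart n₀ i + t < n <;> simp [g, h, blockPart_apply, mul_comm]

/-- Cutting off columns of the last block amounts to padding the vector with zeros. Matching only
nonzero terms of the two sums avoids a case distinction for that block. -/
theorem toEuclideanLin_sketchMatrix_apply (n₀ : ℕ) (m : ℕ → ℕ) (n : ℕ)
    (R : SignIndex n₀ m → ℝ) (v : EuclideanSpace ℝ (Fin n)) (i : Fin (numBlocks n₀ n))
    (r : Fin (m i)) :
    Matrix.toEuclideanLin (sketchMatrix n₀ m n R) v ⟨i, r⟩ =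
      (∑ t, blockPart n₀ n i v t * R ⟨i, r, t⟩) / √(m i : ℝ) := by
  rw [Matrix.ofLp_toLpLin, Matrix.toLin'_apply, Matrix.mulVec, dotProduct, Finset.sum_div]
  refine Finset.sum_bij_ne_zero
    (fun j _ hj => ⟨j - blockStart n₀ i, ?_⟩) ?_ ?_ ?_ ?_
  · by_contra h
    exact hj (by simp [sketchMatrix, h])
  · simp
  · intro j _ hj k _ hk hjk
    have h1 : blockStart n₀ i ≤ j := by
      by_contra h
      exact hj (by simp [sketchMatrix, h])
    have h2 : blockStart n₀ i ≤ k := by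
      by_contra h
      exact hk (by simp [sketchMatrix, h])
    have := congrArg Fin.val hjk
    simp only at this
    ext
    omega
  · intro t _ ht
    by_cases h : blockStart n₀ i + t < n
    · refine ⟨⟨blockStart n₀ i + t, h⟩, Finset.mem_univ _, ?_, ?_⟩
      · have : sketchMatrix n₀ m n R ⟨i, r⟩ ⟨blockStart n₀ i + t, h⟩ =
            R ⟨i, r, t⟩ / √(m i : ℝ) := by simp [sketchMatrix]
        rw [this]
        rw [blockPart_apply, dif_pos h] at ht
        convert! ht using 1
        ring
      · simp
    · exact absurd (by simp [blockPart_apply, h]) ht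
  · intro j _ hj
    have h : blockStart n₀ i ≤ j ∧ (j : ℕ) - blockStart n₀ i < blockSize n₀ i := by
      by_contra h
      exact hj (by simp [sketchMatrix, h])
    simp only [sketchMatrix, Matrix.of_apply, h, and_self, dite_true, blockPart_apply,
      Nat.add_sub_cancel' h.1, j.2, Fin.eta]
    ring

theorem inner_sketchMatrix (n₀ : ℕ) (m : ℕ → ℕ) (n : ℕ)
    (R : SignIndex n₀ m → ℝ) (v w : EuclideanSpace ℝ (Fin n)) :
    inner ℝ (Matrix.toEuclideanLin (sketchMatrix n₀ m n R) v)
      (Matrix.toEuclideanLin (sketchMatrix n₀ m n R) w) =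
    ∑ i ∈ Finset.range (numBlocks n₀ n), ∑ r : Fin (m i),
      (∑ t, blockPart n₀ n i v t * R ⟨i, r, t⟩) * (∑ t, blockPart n₀ n i w t * R ⟨i, r, t⟩) /
        m i := by
  rw [PiLp.inner_apply, Fintype.sum_sigma, Finset.sum_range]
  refine Finset.sum_congr rfl fun i _ => Finset.sum_congr rfl fun r _ => ?_
  rw [toEuclideanLin_sketchMatrix_apply, toEuclideanLin_sketchMatrix_apply]
  simp only [RCLike.inner_apply, conj_trivial]
  rw [div_mul_div_comm, Real.mul_self_sqrt (Nat.cast_nonneg _), mul_comm]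

theorem blockStart_succ (n₀ i : ℕ) :
    blockStart n₀ (i + 1) = blockStart n₀ i + blockSize n₀ i :=
  Finset.sum_range_succ _ _

/-- Blocks `0, …, i` contain at most `2 ^ (i + 1) * n₀` rows. Indexing from `0` makes the base `j +
1 ≥ 1`, so the exponent may be raised to a natural number. -/
theorem abs_le_of_lt_blockStart_succ {c Δ x : ℝ} {n₀ i j : ℕ}
    (hx : |x| ≤ c * ((j : ℝ) + 1) ^ Δ) (hj : j < blockStart n₀ (i + 1)) :
    |x| ≤ |c| * (2 ^ i * (2 * n₀)) ^ ⌈|Δ|⌉₊ := by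
  have hstart (l : ℕ) : blockStart n₀ l ≤ 2 ^ l * n₀ := by
    induction l with
    | zero => simp [blockStart]
    | succ l ih =>
      rw [blockStart_succ, blockSize, pow_succ]
      linarith
  have h1 : (j : ℝ) + 1 ≤ 2 ^ i * (2 * n₀) := by
    have h : j + 1 ≤ 2 ^ i * (2 * n₀) := (Nat.succ_le_of_lt hj).trans
      ((hstart _).trans_eq (by ring))
    exact_mod_cast h
  have hj0 : (0 : ℝ) ≤ j := Nat.cast_nonneg j
  calc |x| ≤ c * ((j : ℝ) + 1) ^ Δ := hx
    _ ≤ |c| * ((j : ℝ) + 1) ^ (⌈|Δ|⌉₊ : ℝ) := by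
      gcongr
      · exact le_abs_self c
      · linarith
      · exact (le_abs_self Δ).trans (Nat.le_ceil _)
    _ ≤ |c| * (2 ^ i * (2 * n₀)) ^ ⌈|Δ|⌉₊ := by
      rw [Real.rpow_natCast]
      gcongr

/-- Cauchy–Schwarz in each row. The exponent `2 * ⌈|Δ|⌉₊` comes from the squared entries, and the
extra `1` from the `2 ^ i * n₀` rows of the block. -/
theorem norm_sq_blockPart_le {d n₀ n : ℕ} {c Δ : ℝ} {a : ℕ → Fin d → ℝ}
    (ha : ∀ j k, |a j k| ≤ c * ((j : ℝ) + 1) ^ Δ) (i : ℕ) (y : EuclideanSpace ℝ (Fin d)) :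
    ‖blockPart n₀ n i (Matrix.toEuclideanLin (prefixMatrix a n) y)‖ ^ 2 ≤
      n₀ * (d * (|c| * (2 * n₀) ^ ⌈|Δ|⌉₊) ^ 2) * (2 ^ i) ^ (2 * ⌈|Δ|⌉₊ + 1) * ‖y‖ ^ 2 := by
  set B : ℝ := |c| * (2 ^ i * (2 * n₀)) ^ ⌈|Δ|⌉₊ with hB
  have hB0 : 0 ≤ B := by positivity
  have hrow (t : Fin (blockSize n₀ i)) :
      (blockPart n₀ n i (Matrix.toEuclideanLin (prefixMatrix a n) y) t) ^ 2 ≤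
        d * B ^ 2 * ‖y‖ ^ 2 := by
    rw [blockPart_apply]
    split_ifs with h
    · rw [Matrix.ofLp_toLpLin, Matrix.toLin'_apply, Matrix.mulVec, dotProduct]
      refine (Finset.sum_mul_sq_le_sq_mul_sq _ _ _).trans ?_
      rw [← EuclideanSpace.real_norm_sq_eq y]
      gcongr
      calc _ ≤ ∑ _k : Fin d, B ^ 2 := by
            refine Finset.sum_le_sum fun k _ => ?_
            rw [← sq_abs]
            refine pow_le_pow_left₀ (abs_nonneg _) ?_ 2
            refine abs_le_of_lt_blockStart_succ (j := blockStart n₀ i + t) (ha _ k) ?_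
            rw [blockStart_succ]
            exact Nat.add_lt_add_left t.2 _
        _ = d * B ^ 2 := by simp
    · rw [zero_pow two_ne_zero]
      positivity
  rw [EuclideanSpace.real_norm_sq_eq]
  calc _ ≤ ∑ _t : Fin (blockSize n₀ i), d * B ^ 2 * ‖y‖ ^ 2 :=
        Finset.sum_le_sum fun t _ => hrow t
    _ = _ := by
        rw [Finset.sum_const, Finset.card_univ, Fintype.card_fin, nsmul_eq_mul, blockSize, hB]
        push_cast
        ring

/-- The blocks of `A x` carry little weight where the error parameters are large. -/
theorem sum_mul_norm_sq_blockPart_le {d n₀ n : ℕ} (hd : 1 ≤ d) (h0 : 1 ≤ n₀) {c Δ κ F : ℝ}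
    {a : ℕ → Fin d → ℝ} (ha : ∀ j k, |a j k| ≤ c * ((j : ℝ) + 1) ^ Δ) {ε : ℕ → ℝ}
    (hε1 : ∀ i, ε i ≤ 1) (hεκ : ∀ i, ε i ≤ κ / (i + 1)) (hF : 1 < F)
    (hσ : F ≤ smallestSingularValue (prefixMatrix a n) ^ 2) (y : EuclideanSpace ℝ (Fin d)) :
    ∑ i ∈ Finset.range (numBlocks n₀ n),
        ε i * ‖blockPart n₀ n i (Matrix.toEuclideanLin (prefixMatrix a n) y)‖ ^ 2 ≤
      (2 * (2 * ⌈|Δ|⌉₊ + 1 : ℕ) * |κ| + 4 * (n₀ * (d * (|c| * (2 * n₀) ^ ⌈|Δ|⌉₊) ^ 2)) + 1) /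
        Real.log F * ‖Matrix.toEuclideanLin (prefixMatrix a n) y‖ ^ 2 := by
  -- The singular value hypothesis enters here: it makes `‖y‖ ^ 2` small compared with `‖A y‖ ^ 2`.
  have hy : ‖y‖ ^ 2 ≤ ‖Matrix.toEuclideanLin (prefixMatrix a n) y‖ ^ 2 / F := by
    rw [le_div_iff₀ (by linarith), mul_comm]
    exact (mul_le_mul_of_nonneg_right hσ (sq_nonneg _)).trans
      (sq_smallestSingularValue_mul_le hd _ y)
  refine sum_mul_le_div_log (by omega) (by positivity) hF (sq_nonneg _) hε1 hεκ
    (fun i _ => sq_nonneg _) (fun i _ => ?_) ?_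
  · refine (norm_sq_blockPart_le ha i y).trans ?_
    gcongr
  · simp_rw [← real_inner_self_eq_norm_sq]
    exact sum_inner_blockPart h0 n _ _

/-- The column space of `A` together with `b`. -/
noncomputable def columnSpan {d n : ℕ} (A : Matrix (Fin n) (Fin d) ℝ) (b : EuclideanSpace ℝ (Fin n)) :
    Submodule ℝ (EuclideanSpace ℝ (Fin n)) :=
  LinearMap.range (Matrix.toEuclideanLin A) ⊔ Submodule.span ℝ {b}

theorem apply_mem_columnSpan {d n : ℕ} (A : Matrix (Fin n) (Fin d) ℝ)
    (b : EuclideanSpace ℝ (Fin n)) (x : EuclideanSpace ℝ (Fin d)) :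
    Matrix.toEuclideanLin A x ∈ columnSpan A b :=
  Submodule.mem_sup_left (LinearMap.mem_range_self _ x)

theorem sub_mem_columnSpan {d n : ℕ} (A : Matrix (Fin n) (Fin d) ℝ)
    (b : EuclideanSpace ℝ (Fin n)) (x : EuclideanSpace ℝ (Fin d)) :
    Matrix.toEuclideanLin A x - b ∈ columnSpan A b :=
  Submodule.sub_mem _ (apply_mem_columnSpan A b x)
    (Submodule.mem_sup_right (Submodule.mem_span_singleton_self b))

theorem finrank_columnSpan_le {d n : ℕ} (A : Matrix (Fin n) (Fin d) ℝ)
    (b : EuclideanSpace ℝ (Fin n)) : Module.finrank ℝ (columnSpan A b) ≤ d + 1 := by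
  refine (Submodule.finrank_add_le_finrank_add_finrank _ _).trans (add_le_add ?_ ?_)
  · exact (LinearMap.finrank_range_le _).trans_eq (by simp)
  · exact (finrank_span_le_card {b}).trans_eq (by simp)

/-- If every block of the sketch preserves the inner products of the blocks of a subspace, the
sketch preserves its inner products with a weighted error. -/
theorem abs_inner_sketchMatrix_sub_le {n₀ n : ℕ} (h0 : 1 ≤ n₀) {m : ℕ → ℕ}
    {R : SignIndex n₀ m → ℝ} {ε : ℕ → ℝ} (hε : ∀ i, 0 ≤ ε i)
    {W : Submodule ℝ (EuclideanSpace ℝ (Fin n))}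
    (hR : ∀ i ∈ Finset.range (numBlocks n₀ n), ∀ x ∈ W.map (blockPart n₀ n i),
      ∀ y ∈ W.map (blockPart n₀ n i),
      |∑ r, (∑ t, x t * R ⟨i, r, t⟩) * (∑ t, y t * R ⟨i, r, t⟩) / m i - inner ℝ x y| ≤
        √(ε i) / 2 * ‖x‖ * ‖y‖) {v w : EuclideanSpace ℝ (Fin n)} (hv : v ∈ W) (hw : w ∈ W) :
    |inner ℝ (Matrix.toEuclideanLin (sketchMatrix n₀ m n R) v)
        (Matrix.toEuclideanLin (sketchMatrix n₀ m n R) w) - inner ℝ v w| ≤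
      √(∑ i ∈ Finset.range (numBlocks n₀ n), ε i * ‖blockPart n₀ n i v‖ ^ 2) / 2 * ‖w‖ := by
  have hw2 : ‖w‖ = √(∑ i ∈ Finset.range (numBlocks n₀ n), ‖blockPart n₀ n i w‖ ^ 2) := by
    simp_rw [← real_inner_self_eq_norm_sq]
    rw [sum_inner_blockPart h0, real_inner_self_eq_norm_sq, Real.sqrt_sq (norm_nonneg _)]
  rw [inner_sketchMatrix, ← sum_inner_blockPart h0 n v w, ← Finset.sum_sub_distrib]
  calc _ ≤ ∑ i ∈ Finset.range (numBlocks n₀ n),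
        √(ε i) / 2 * ‖blockPart n₀ n i v‖ * ‖blockPart n₀ n i w‖ :=
        (Finset.abs_sum_le_sum_abs _ _).trans (Finset.sum_le_sum fun i hi =>
          hR i hi _ (Submodule.mem_map_of_mem hv) _ (Submodule.mem_map_of_mem hw))
    _ = (∑ i ∈ Finset.range (numBlocks n₀ n),
        √(ε i) * ‖blockPart n₀ n i v‖ * ‖blockPart n₀ n i w‖) / 2 := by
        rw [Finset.sum_div]
        exact Finset.sum_congr rfl fun i _ => by ring
    _ ≤ (√(∑ i ∈ Finset.range (numBlocks n₀ n), (√(ε i) * ‖blockPart n₀ n i v‖) ^ 2) *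
        √(∑ i ∈ Finset.range (numBlocks n₀ n), ‖blockPart n₀ n i w‖ ^ 2)) / 2 := by
        gcongr
        -- Cauchy–Schwarz over the blocks puts all the weights `√(ε i)` on `v`. This matters because
        -- only the block shares of `A x` are controlled, not those of the residual.
        exact Real.sum_mul_le_sqrt_mul_sqrt _ _ _
    _ = _ := by
        rw [← hw2]
        simp_rw [mul_pow, Real.sq_sqrt (hε _)]
        ring

/-! ### Assembly by a union bound over the blocks. -/

theorem mainTheorem8 :
    ∃ C : ℝ, 0 < C ∧
      ∀ (d n₀ : ℕ) (c Δ κ : ℝ), 1 ≤ d → 1 ≤ n₀ →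
      ∃ K : ℝ, 0 < K ∧
        ∀ (a : ℕ → Fin d → ℝ) (b : ℕ → ℝ) (f : ℕ → ℝ)
          (δ : ℝ) (εs δs : ℕ → ℝ) (m : ℕ → ℕ)
          (Ω : Type*) [MeasurableSpace Ω] (μ : Measure Ω) [IsProbabilityMeasure μ]
          (R : SignIndex n₀ m → Ω → ℝ),
          -- polynomially bounded entries
          (∀ j k, |a j k| ≤ c * ((j : ℝ) + 1) ^ Δ) →
          (∀ n, 0 < f n) → Monotone f → Tendsto f atTop atTop →
          0 < δ → δ < 1 / 2 →
          -- error parameters of the blocks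
          (∀ i, 0 < εs i ∧ εs i ≤ 1 ∧ εs i ≤ κ / ((i : ℝ) + 1)) →
          -- failure probabilities of the blocks
          (∀ i, 0 < δs i) → Summable δs → ∑' i, δs i ≤ δ →
          -- numbers of rows of the blocks
          (∀ i, C * d / εs i * Real.log (1 / δs i) ≤ m i) →
          IsRandomSigns μ R →
          ∀ n : ℕ, 1 < f n → f n ≤ smallestSingularValue (prefixMatrix a n) ^ 2 →
            ENNReal.ofReal (1 - δ) ≤
              μ {ω | ∀ xt xs : EuclideanSpace ℝ (Fin d),
                IsLeastSquaresSolution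
                  (sketchMatrix n₀ m n (fun k => R k ω) * prefixMatrix a n)
                  (Matrix.toEuclideanLin (sketchMatrix n₀ m n (fun k => R k ω))
                    (prefixVector b n)) xt →
                IsLeastSquaresSolution (prefixMatrix a n) (prefixVector b n) xs →
                residualNorm (prefixMatrix a n) (prefixVector b n) xt ≤
                  (1 + K / Real.log (f n)) *
                    residualNorm (prefixMatrix a n) (prefixVector b n) xs} := by
  refine ⟨1000000, by norm_num, fun d n₀ c Δ κ hd h0 => ?_⟩
  refine ⟨2 * (2 * ⌈|Δ|⌉₊ + 1 : ℕ) * |κ| + 4 * (n₀ * (d * (|c| * (2 * n₀) ^ ⌈|Δ|⌉₊) ^ 2)) + 1,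
    by positivity, ?_⟩
  intro a b f δ εs δs m Ω _ μ _ R ha _ _ _ hδ hδ1 hε hδs hsum hδsum hm hR n hf hσ
  set K : ℝ :=
    2 * (2 * ⌈|Δ|⌉₊ + 1 : ℕ) * |κ| + 4 * (n₀ * (d * (|c| * (2 * n₀) ^ ⌈|Δ|⌉₊) ^ 2)) + 1
  have hK : 0 < K := by positivity
  have hL : 0 < Real.log (f n) := Real.log_pos hf
  set A := prefixMatrix a n
  set W := columnSpan A (prefixVector b n)
  let bad (i : ℕ) : Set Ω := {ω | ¬ ∀ x ∈ W.map (blockPart n₀ n i),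
    ∀ y ∈ W.map (blockPart n₀ n i),
      |∑ r, (∑ t, x t * R ⟨i, r, t⟩ ω) * (∑ t, y t * R ⟨i, r, t⟩ ω) / m i - inner ℝ x y| ≤
        √(εs i) / 2 * ‖x‖ * ‖y‖}
  have hδsi (i : ℕ) : δs i < 1 / 2 :=
    ((hsum.le_tsum i fun j _ => (hδs j).le).trans hδsum).trans_lt hδ1
  have hbad (i : ℕ) : μ.real (bad i) ≤ δs i := by
    have hX : IsRandomSigns μ fun p : Fin (m i) × Fin (blockSize n₀ i) => R ⟨i, p⟩ :=
      hR.precomp (g := fun p => (⟨i, p⟩ : SignIndex n₀ m)) fun p q h =>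
        eq_of_heq (Sigma.mk.inj h).2
    exact hX.measure_not_sketch_le (W.map (blockPart n₀ n i))
      ((Submodule.finrank_map_le _ _).trans (finrank_columnSpan_le A _)) hd (hε i).1 (hε i).2.1
      (hδs i) (hδsi i) (hm i)
  have hbads : μ.real (⋃ i ∈ Finset.range (numBlocks n₀ n), bad i) ≤ δ :=
    (measureReal_biUnion_finset_le _ _).trans <|
      (Finset.sum_le_sum fun i _ => hbad i).trans <|
        (hsum.sum_le_tsum _ fun i _ => (hδs i).le).trans hδsum
  have hgood : (⋃ i ∈ Finset.range (numBlocks n₀ n), bad i)ᶜ ⊆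
      {ω | ∀ xt xs : EuclideanSpace ℝ (Fin d),
        IsLeastSquaresSolution (sketchMatrix n₀ m n (fun k => R k ω) * A)
          (Matrix.toEuclideanLin (sketchMatrix n₀ m n (fun k => R k ω)) (prefixVector b n)) xt →
        IsLeastSquaresSolution A (prefixVector b n) xs →
        residualNorm A (prefixVector b n) xt ≤
          (1 + K / Real.log (f n)) * residualNorm A (prefixVector b n) xs} := by
    intro ω hω xt xs ht hs
    simp only [Set.compl_iUnion, Set.mem_iInter] at hω
    have hinner {v w : EuclideanSpace ℝ (Fin n)} (hv : v ∈ W) (hw : w ∈ W) :=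
      abs_inner_sketchMatrix_sub_le h0 (R := fun k => R k ω) (fun i => (hε i).1.le)
        (fun i hi => not_not.1 (hω i hi)) hv hw
    refine residualNorm_le_of_sketch (by positivity) (fun x => ?_) (fun x z => ?_) ht hs
    -- As `εs i ≤ 1`, the error here is at most `‖v‖ ^ 2 / 2`.
    · have h := hinner (apply_mem_columnSpan A _ x) (apply_mem_columnSpan A _ x)
      rw [real_inner_self_eq_norm_sq, real_inner_self_eq_norm_sq] at h
      set v := Matrix.toEuclideanLin A x
      have h1 : ∑ i ∈ Finset.range (numBlocks n₀ n), εs i * ‖blockPart n₀ n i v‖ ^ 2 ≤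
          ‖v‖ ^ 2 := by
        rw [← real_inner_self_eq_norm_sq v, ← sum_inner_blockPart h0]
        refine Finset.sum_le_sum fun i _ => ?_
        rw [real_inner_self_eq_norm_sq]
        exact mul_le_of_le_one_left (sq_nonneg _) (hε i).2.1
      have h2 := Real.sqrt_le_sqrt h1
      rw [Real.sqrt_sq (norm_nonneg _)] at h2
      have h3 := (abs_le.1 h).1
      nlinarith [norm_nonneg v]
    · refine (hinner (apply_mem_columnSpan A _ x) (sub_mem_columnSpan A _ z)).trans ?_
      have h := Real.sqrt_le_sqrt (sum_mul_norm_sq_blockPart_le hd h0 ha (fun i => (hε i).2.1)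
        (fun i => (hε i).2.2) hf hσ x)
      rw [Real.sqrt_mul (by positivity), Real.sqrt_sq (norm_nonneg _)] at h
      linarith [mul_le_mul_of_nonneg_right h (norm_nonneg
        (Matrix.toEuclideanLin A z - prefixVector b n))]
  refine le_trans ?_ (measure_mono hgood)
  rw [← ENNReal.ofReal_toReal (measure_ne_top μ _)]
  refine ENNReal.ofReal_le_ofReal ?_
  -- Subadditivity alone bounds the complement from below, so the bad events need not be measurable.
  have h1 : μ.real Set.univ ≤ μ.real (⋃ i ∈ Finset.range (numBlocks n₀ n), bad i) +
      μ.real (⋃ i ∈ Finset.range (numBlocks n₀ n), bad i)ᶜ := by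
    rw [← Set.union_compl_self (⋃ i ∈ Finset.range (numBlocks n₀ n), bad i)]
    exact measureReal_union_le _ _
  rw [probReal_univ] at h1
  change 1 - δ ≤ μ.real _
  linarith
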